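/- Let $k\ge 3$ and $n\ge 0$ be integers. A permutation $\alpha$ of $[n]=\{1,\dots,n\}$ contains a permutation $\tau$ of $[m]$ if there are indices $i_1<\dots<i_m$ such that $(\alpha_{i_1},\dots,\alpha_{i_m})$ is order-isomorphic to $\tau$, and avoids $\tau$ otherwise; $\alpha$ is an involution if $\alpha(\alpha(i))=i$ for all $i$. Let $A$ be the set of involutions of $[n]$ that avoid both $132$ and $12\ldots k$, and let $B$ be the set of involutions of $[n]$ that avoid both $132$ and $2134\ldots k$ (the pattern obtained from $12\ldots k$ by exchanging its first two letters). Then there is a bijection $\Phi\colon A\to B$ such that: 1. for every $p$ with $0\le p\le k-3$ and every $\pi\in A$, the involution $\pi$ has exactly $p$ fixed points if and only if $\Phi(\pi)$ has exactly $p$ fixed points; 2. for every $\pi\in A$, the involution $\pi$ has exactly $k-2$ or exactly $k-1$ fixed points if and only if $\Phi(\pi)$ has $k-2$ or more fixed points. -/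

import Mathlib

namespace PatternInvolutions

/-- `α` contains the pattern `τ`: some subsequence of `α`, read from left to right at increasing
positions, is order-isomorphic to `τ`. -/
def Contains {n k : ℕ} (α : Equiv.Perm (Fin n)) (τ : Equiv.Perm (Fin k)) : Prop :=
  ∃ f : Fin k → Fin n, StrictMono f ∧ ∀ i j : Fin k, α (f i) < α (f j) ↔ τ i < τ j

/-- `α` avoids the pattern `τ`. -/
def Avoids {n k : ℕ} (α : Equiv.Perm (Fin n)) (τ : Equiv.Perm (Fin k)) : Prop :=
  ¬ Contains α τ

/-- The pattern `132` (with letters and positions counted from `0`, the one-line word `0 2 1`). -/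
def pattern132 : Equiv.Perm (Fin 3) := Equiv.swap 1 2

/-- The pattern `12…k`. -/
def patternIncreasing (k : ℕ) : Equiv.Perm (Fin k) := Equiv.refl (Fin k)

/-- The pattern `2134…k`: the first two letters of `12…k` are exchanged. -/
def pattern2134 (k : ℕ) (hk : 2 ≤ k) : Equiv.Perm (Fin k) :=
  Equiv.swap ⟨0, by omega⟩ ⟨1, by omega⟩

/-- The involutions of length `n` that avoid both `132` and `τ`. -/
def involutionsAvoiding132And (n : ℕ) {k : ℕ} (τ : Equiv.Perm (Fin k)) :
    Set (Equiv.Perm (Fin n)) :=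
  {α | Function.Involutive α ∧ Avoids α pattern132 ∧ Avoids α τ}

/-- The number of fixed points of `α`. -/
def numFixedPoints {n : ℕ} (α : Equiv.Perm (Fin n)) : ℕ :=
  (Finset.univ.filter fun i => α i = i).card

end PatternInvolutions

namespace PatternInvolutions

open Equiv

/-! In a permutation of `n + 1` letters that avoids 132, every letter before the maximum exceeds
every letter after it. With the maximum at position `j`, it is therefore (α ⊕ 1) ⊖ β with α on `j`
letters (`exists_skew_of_apply`). It avoids τ ⊕ 1 exactly when α avoids τ and β avoids τ ⊕ 1, α and
β both avoiding 132.

For an involution there are two cases. If `j = n`, it is μ ⊕ 1: the forbidden pattern drops from τ ⊕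
1 to τ and one fixed point is lost. Otherwise it is (σ ⊕ 1) ⊖ μ ⊖ (σ ⊕ 1)⁻¹, where σ is any avoider
of τ and μ is an involution under the same restriction as the whole; all fixed points lie in μ
(`exists_skewConj`, `fixedBelow_skewConj`).

The recursion is the same for any family of patterns that grows by ⊕ 1. Induction on the number `k`
of letters added to 12 and 21, then on `n`, gives a bijection preserving min(fixed points, `k`)
(`exists_equiv_involutiveAvoiders`). At the base each class has a single element, and the cap 0
ignores that their fixed points differ. An avoider of an increasing pattern has fewer fixed points
than the pattern has letters, which turns the capped statement into the theorem.

Permutations of different lengths all live in `Perm ℕ`, so blocks can be cut and glued without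
casts. -/

/-- The permutations of `ℕ` that fix every number from `n` on. -/
def supportedBelow (n : ℕ) : Set (Perm ℕ) := {π | ∀ i, n ≤ i → π i = i}

/-- The restriction of `π` to the numbers below `n` contains the pattern `τ`. -/
def ContainsBelow {k : ℕ} (n : ℕ) (π : Perm ℕ) (τ : Perm (Fin k)) : Prop :=
  ∃ f : Fin k → ℕ, StrictMono f ∧ (∀ i, f i < n) ∧ ∀ i j, π (f i) < π (f j) ↔ τ i < τ j

/-- The permutations of the numbers below `n` that avoid `132` and `τ`. -/
def avoiders {k : ℕ} (τ : Perm (Fin k)) (n : ℕ) : Set (Perm ℕ) :=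
  {π | π ∈ supportedBelow n ∧ ¬ ContainsBelow n π pattern132 ∧ ¬ ContainsBelow n π τ}

/-- The involutions of the numbers below `n` that avoid `132` and `τ`. -/
def involutiveAvoiders {k : ℕ} (τ : Perm (Fin k)) (n : ℕ) : Set (Perm ℕ) :=
  {π | π ∈ avoiders τ n ∧ ∀ i, π (π i) = i}

/-- The number of fixed points of `π` below `n`. -/
def fixedBelow (n : ℕ) (π : Perm ℕ) : ℕ := ((Finset.range n).filter fun i => π i = i).card

/-- `τ'` is the direct sum of `τ` and the permutation of length one. -/
def IsExtension {k : ℕ} (τ : Perm (Fin k)) (τ' : Perm (Fin (k + 1))) : Prop :=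
  τ' (Fin.last k) = Fin.last k ∧ ∀ i, τ' (Fin.castSucc i) = Fin.castSucc (τ i)

/-- The permutation exchanging the blocks `[0, a)` and `[a, a + b)`. -/
def blockSwap (a b : ℕ) : Perm ℕ where
  toFun i := if i < a then i + b else if i < a + b then i - a else i
  invFun i := if i < b then i + a else if i < a + b then i - b else i
  left_inv i := by dsimp only; split_ifs <;> omega
  right_inv i := by dsimp only; split_ifs <;> omega

/-- The permutation `β` acting on the numbers from `a` on. -/
def shift (a : ℕ) (β : Perm ℕ) : Perm ℕ where
  toFun i := if i < a then i else β (i - a) + a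
  invFun i := if i < a then i else β.symm (i - a) + a
  left_inv i := by
    dsimp only
    by_cases h : i < a
    · simp [h]
    · simp [h]; omega
  right_inv i := by
    dsimp only
    by_cases h : i < a
    · simp [h]
    · simp [h]; omega

/-- The skew sum of `α` (on the numbers below `a`) and `β` (on the numbers below `b`). -/
def skew (a b : ℕ) (α β : Perm ℕ) : Perm ℕ := blockSwap a b * (α * shift a β)

/-! ### Skew sums of finitely supported permutations. -/

section supported

variable {n a b i : ℕ} {π α β α' β' : Perm ℕ}

theorem lt_of_supported (hπ : π ∈ supportedBelow n) (hi : i < n) : π i < n := by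
  by_contra h
  have h1 := hπ _ (not_lt.1 h)
  have := π.injective h1
  omega

theorem inv_mem_supported (hπ : π ∈ supportedBelow n) : π⁻¹ ∈ supportedBelow n := by
  intro i hi
  rw [Perm.inv_eq_iff_eq, hπ i hi]

theorem supported_mono (hπ : π ∈ supportedBelow a) (hab : a ≤ b) : π ∈ supportedBelow b :=
  fun i hi => hπ i (hab.trans hi)

theorem supported_of_succ (hπ : π ∈ supportedBelow (n + 1)) (h : π n = n) :
    π ∈ supportedBelow n := by
  intro i hi
  rcases hi.eq_or_lt with rfl | hi
  · exact h
  · exact hπ i hi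

theorem supported_ext (hα : α ∈ supportedBelow n) (hα' : α' ∈ supportedBelow n)
    (h : ∀ i < n, α i = α' i) : α = α' := by
  ext i
  by_cases hi : i < n
  · exact h i hi
  · rw [hα i (not_lt.1 hi), hα' i (not_lt.1 hi)]

theorem skew_left (hα : α ∈ supportedBelow a) (hi : i < a) : skew a b α β i = α i + b := by
  have := lt_of_supported hα hi
  simp [skew, blockSwap, shift, hi, this]

theorem skew_right (hα : α ∈ supportedBelow a) (hβ : β ∈ supportedBelow b) (hi : i < b) :
    skew a b α β (i + a) = β i := by
  have h1 := lt_of_supported hβ hi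
  have h2 : α (β i + a) = β i + a := hα _ (by omega)
  have h3 : β i + a < a + b := by omega
  simp [skew, blockSwap, shift, h2, h3]

theorem skew_supported (hα : α ∈ supportedBelow a) (hβ : β ∈ supportedBelow b) :
    skew a b α β ∈ supportedBelow (a + b) := by
  intro i hi
  have h0 : ¬ i < a := by omega
  have h1 : β (i - a) = i - a := hβ _ (by omega)
  have h2 : α i = i := hα _ (by omega)
  have h3 : i - a + a = i := by omega
  have h4 : ¬ i < a + b := by omega
  simp [skew, blockSwap, shift, h0, h1, h2, h3, h4]

theorem skew_injective (hα : α ∈ supportedBelow a) (hβ : β ∈ supportedBelow b)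
    (hα' : α' ∈ supportedBelow a) (hβ' : β' ∈ supportedBelow b)
    (h : skew a b α β = skew a b α' β') : α = α' ∧ β = β' := by
  constructor
  · refine supported_ext hα hα' fun i hi => ?_
    have := congrArg (fun π : Perm ℕ => π i) h
    simpa [skew_left hα hi, skew_left hα' hi] using this
  · refine supported_ext hβ hβ' fun i hi => ?_
    have := congrArg (fun π : Perm ℕ => π (i + a)) h
    simpa [skew_right hα hβ hi, skew_right hα' hβ' hi] using this

theorem exists_eq_skew (hπ : π ∈ supportedBelow (a + b)) (h : ∀ i < a, b ≤ π i) :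
    ∃ α ∈ supportedBelow a, ∃ β ∈ supportedBelow b, π = skew a b α β := by
  -- Undoing the exchange of value blocks leaves a direct sum: ρ preserves `[0, a)`, hence also its
  -- complement.
  set ρ : Perm ℕ := (blockSwap a b)⁻¹ * π with hρ
  have hπρ : π = blockSwap a b * ρ := by simp [hρ]
  have hmap : Set.MapsTo ρ (Set.Iio a) (Set.Iio a) := by
    intro i hi
    have hi : i < a := hi
    have h1 := h i hi
    have h2 : π i < a + b := lt_of_supported hπ (by omega)
    have h3 : ρ i = (blockSwap a b).symm (π i) := rfl
    have h4 : ¬ π i < b := by omega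
    simp [h3, blockSwap, h4, h2]
    omega
  have hmap' := Perm.perm_symm_mapsTo_of_mapsTo ρ hmap
  have hlt : ∀ i, i < a → ρ i < a := fun i hi => hmap hi
  have hlt' : ∀ i, i < a → ρ.symm i < a := fun i hi => hmap' hi
  have hge : ∀ i, a ≤ i → a ≤ ρ i := by
    intro i hi
    by_contra hc
    have := hlt' _ (not_le.1 hc)
    simp at this
    omega
  have hge' : ∀ i, a ≤ i → a ≤ ρ.symm i := by
    intro i hi
    by_contra hc
    have := hlt _ (not_le.1 hc)
    simp at this
    omega
  let α : Perm ℕ :=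
    { toFun := fun i => if i < a then ρ i else i
      invFun := fun i => if i < a then ρ.symm i else i
      left_inv := by
        intro i
        by_cases hi : i < a
        · simp [hi, hlt i hi]
        · simp [hi]
      right_inv := by
        intro i
        by_cases hi : i < a
        · simp [hi, hlt' i hi]
        · simp [hi] }
  let β : Perm ℕ :=
    { toFun := fun i => ρ (i + a) - a
      invFun := fun i => ρ.symm (i + a) - a
      left_inv := by
        intro i
        have := hge (i + a) (by omega)
        simp [Nat.sub_add_cancel this]
      right_inv := by
        intro i
        have := hge' (i + a) (by omega)
        simp [Nat.sub_add_cancel this] }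
  refine ⟨α, fun i hi => ?_, β, fun i hi => ?_, ?_⟩
  · have : ¬ i < a := by omega
    simp [α, this]
  · have h1 : π (i + a) = i + a := hπ _ (by omega)
    have h2 : ρ (i + a) = (blockSwap a b).symm (i + a) := by
      rw [hρ, Perm.mul_apply, h1]; rfl
    have h3 : ¬ i + a < b := by omega
    have h4 : ¬ i + a < a + b := by omega
    simp [β, h2, blockSwap, h3, h4]
  · rw [hπρ, skew]
    congr 1
    ext i
    by_cases hi : i < a
    · simp [α, shift, hi]
    · have h1 : i - a + a = i := by omega
      have h2 : ρ i - a + a = ρ i := by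
        have := hge i (by omega)
        omega
      have h3 : ¬ ρ i < a := by
        have := hge i (by omega)
        omega
      simp [α, β, shift, hi, h1, h2, h3]

end supported

/-! ### Pattern containment under skew sum, appended maximum and inverse. -/

section patterns

variable {n a b k : ℕ} {π α β : Perm ℕ}

/-- An occurrence cannot straddle the two blocks, since the left one has the larger values. A last
letter that is the maximum, or a first letter that is the minimum, drags all the others into its own
block. The first case serves τ ⊕ 1, the second 132. -/
theorem ContainsBelow.of_skew {τ : Perm (Fin (k + 1))} (hα : α ∈ supportedBelow a)
    (hβ : β ∈ supportedBelow b) (hτ : τ (Fin.last k) = Fin.last k ∨ τ 0 = 0)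
    (h : ContainsBelow (a + b) (skew a b α β) τ) :
    ContainsBelow a α τ ∨ ContainsBelow b β τ := by
  obtain ⟨f, hf, hfn, hft⟩ := h
  have hright : ∀ i, a ≤ f i → skew a b α β (f i) = β (f i - a) := by
    intro i hi
    have h1 : f i - a < b := by have := hfn i; omega
    have h2 := skew_right hα hβ h1
    rwa [Nat.sub_add_cancel hi] at h2
  have hle : ∀ i j, τ i ≤ τ j → skew a b α β (f i) ≤ skew a b α β (f j) := by
    intro i j hij
    by_contra hc
    exact absurd ((hft j i).1 (not_le.1 hc)) (not_lt.2 hij)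
  have hbig : ∀ i, f i < a → b ≤ skew a b α β (f i) := by
    intro i hi
    rw [skew_left hα hi]; omega
  have hsmall : ∀ i, a ≤ f i → skew a b α β (f i) < b := by
    intro i hi
    rw [hright i hi]
    exact lt_of_supported hβ (by have := hfn i; omega)
  have key : (∀ i, f i < a) ∨ (∀ i, a ≤ f i) := by
    rcases hτ with hτ | hτ
    · rcases lt_or_ge (f (Fin.last k)) a with hl | hl
      · exact Or.inl fun i => (hf.monotone (Fin.le_last i)).trans_lt hl
      · refine Or.inr fun i => ?_
        by_contra hc
        have h1 := hbig i (not_le.1 hc)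
        have h2 := hsmall _ hl
        have h3 := hle i (Fin.last k) (by rw [hτ]; exact Fin.le_last _)
        omega
    · rcases lt_or_ge (f 0) a with hl | hl
      · refine Or.inl fun i => ?_
        by_contra hc
        have h1 := hsmall i (not_lt.1 hc)
        have h2 := hbig _ hl
        have h3 := hle 0 i (by rw [hτ]; exact Fin.zero_le _)
        omega
      · exact Or.inr fun i => hl.trans (hf.monotone (Fin.zero_le i))
  rcases key with hl | hr
  · refine Or.inl ⟨f, hf, hl, fun i j => ?_⟩
    rw [← hft i j, skew_left hα (hl i), skew_left hα (hl j)]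
    omega
  · refine Or.inr ⟨fun i => f i - a, fun i j hij => ?_, fun i => ?_, fun i j => ?_⟩
    · have := hf hij
      have := hr i
      dsimp only
      omega
    · have := hfn i
      have := hr i
      dsimp only
      omega
    · rw [← hft i j, hright i (hr i), hright j (hr j)]

theorem ContainsBelow.skew_left {τ : Perm (Fin k)} (hα : α ∈ supportedBelow a)
    (h : ContainsBelow a α τ) : ContainsBelow (a + b) (skew a b α β) τ := by
  obtain ⟨f, hf, hfn, hft⟩ := h
  refine ⟨f, hf, fun i => by have := hfn i; omega, fun i j => ?_⟩
  rw [← hft i j, PatternInvolutions.skew_left hα (hfn i),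
    PatternInvolutions.skew_left hα (hfn j)]
  omega

theorem ContainsBelow.skew_right {τ : Perm (Fin k)} (hα : α ∈ supportedBelow a)
    (hβ : β ∈ supportedBelow b) (h : ContainsBelow b β τ) :
    ContainsBelow (a + b) (skew a b α β) τ := by
  obtain ⟨f, hf, hfn, hft⟩ := h
  refine ⟨fun i => f i + a, fun i j hij => by have := hf hij; dsimp only; omega,
    fun i => by have := hfn i; dsimp only; omega, fun i j => ?_⟩
  rw [← hft i j, PatternInvolutions.skew_right hα hβ (hfn i),
    PatternInvolutions.skew_right hα hβ (hfn j)]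

theorem containsBelow_skew_iff {τ : Perm (Fin (k + 1))} (hα : α ∈ supportedBelow a)
    (hβ : β ∈ supportedBelow b) (hτ : τ (Fin.last k) = Fin.last k ∨ τ 0 = 0) :
    ContainsBelow (a + b) (skew a b α β) τ ↔ ContainsBelow a α τ ∨ ContainsBelow b β τ :=
  ⟨fun h => h.of_skew hα hβ hτ, fun h => h.elim (·.skew_left hα) (·.skew_right hα hβ)⟩

theorem containsBelow_succ_iff {τ : Perm (Fin k)} {τ' : Perm (Fin (k + 1))}
    (hτ : IsExtension τ τ') (hπ : π ∈ supportedBelow n) :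
    ContainsBelow (n + 1) π τ' ↔ ContainsBelow n π τ := by
  constructor
  · rintro ⟨f, hf, hfn, hft⟩
    refine ⟨fun i => f i.castSucc, fun i j hij => hf (by simpa using hij), fun i => ?_,
      fun i j => ?_⟩
    · have h1 := hf (Fin.castSucc_lt_last i)
      have h2 := hfn (Fin.last k)
      dsimp only
      omega
    · rw [hft, hτ.2, hτ.2, Fin.castSucc_lt_castSucc_iff]
  · rintro ⟨f, hf, hfn, hft⟩
    refine ⟨Fin.snoc (α := fun _ => ℕ) f n, ?_, ?_, ?_⟩
    · intro i j
      refine Fin.lastCases ?_ (fun j => ?_) j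
      · refine Fin.lastCases ?_ (fun i => ?_) i
        · simp
        · simpa using hfn i
      · refine Fin.lastCases ?_ (fun i => ?_) i
        · intro h
          exact absurd h (not_lt.2 (Fin.le_last _))
        · simpa using fun h => hf h
    · intro i
      refine Fin.lastCases ?_ (fun i => ?_) i
      · simp
      · have := hfn i
        simp; omega
    · intro i j
      have hn : π n = n := hπ n le_rfl
      refine Fin.lastCases ?_ (fun j => ?_) j
      · refine Fin.lastCases ?_ (fun i => ?_) i
        · simp
        · simp [hτ.1, hτ.2, hn, lt_of_supported hπ (hfn i)]
      · refine Fin.lastCases ?_ (fun i => ?_) i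
        · have := lt_of_supported hπ (hfn j)
          have h2 := Fin.castSucc_lt_last (τ j)
          simp only [Fin.snoc_last, Fin.snoc_castSucc, hτ.1, hτ.2, hn, this.not_gt, h2.not_gt]
        · simp [hτ.2, hft]

theorem containsBelow_pattern132_iff :
    ContainsBelow n π pattern132 ↔
      ∃ x y z, x < y ∧ y < z ∧ z < n ∧ π x < π z ∧ π z < π y := by
  constructor
  · rintro ⟨f, hf, hfn, hft⟩
    exact ⟨f 0, f 1, f 2, hf (by decide), hf (by decide), hfn 2, (hft 0 2).2 (by decide),
      (hft 2 1).2 (by decide)⟩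
  · rintro ⟨x, y, z, hxy, hyz, hz, hxz, hzy⟩
    refine ⟨![x, y, z], ?_, ?_, ?_⟩
    · intro i j hij
      fin_cases i <;> fin_cases j <;> simp at hij ⊢ <;> omega
    · intro i
      fin_cases i <;> simp <;> omega
    · intro i j
      fin_cases i <;> fin_cases j <;> simp [pattern132, swap_apply_def] <;> omega

/-- The appended letter is last and largest, while the last letter of 132 is not its largest. -/
theorem containsBelow_succ_pattern132_iff (hπ : π ∈ supportedBelow n) :
    ContainsBelow (n + 1) π pattern132 ↔ ContainsBelow n π pattern132 := by
  simp only [containsBelow_pattern132_iff]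
  constructor
  · rintro ⟨x, y, z, hxy, hyz, hz, hxz, hzy⟩
    refine ⟨x, y, z, hxy, hyz, ?_, hxz, hzy⟩
    by_contra hc
    have h1 : z = n := by omega
    have h2 : π z = n := by rw [h1]; exact hπ n le_rfl
    have h3 := lt_of_supported hπ (show y < n by omega)
    omega
  · rintro ⟨x, y, z, hxy, hyz, hz, hxz, hzy⟩
    exact ⟨x, y, z, hxy, hyz, by omega, hxz, hzy⟩

theorem ContainsBelow.inv {τ : Perm (Fin k)} (hτ : ∀ i, τ (τ i) = i) (hπ : π ∈ supportedBelow n)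
    (h : ContainsBelow n π τ) : ContainsBelow n π⁻¹ τ := by
  obtain ⟨f, hf, hfn, hft⟩ := h
  -- The values of the occurrence, listed increasingly, are positions for π⁻¹; they carry the
  -- pattern τ⁻¹ = τ.
  refine ⟨fun i => π (f (τ i)), fun i j hij => (hft _ _).2 (by simpa [hτ] using hij),
    fun i => lt_of_supported hπ (hfn _), fun i j => ?_⟩
  simpa using hf.lt_iff_lt

theorem containsBelow_inv_iff {τ : Perm (Fin k)} (hτ : ∀ i, τ (τ i) = i)
    (hπ : π ∈ supportedBelow n) : ContainsBelow n π⁻¹ τ ↔ ContainsBelow n π τ :=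
  ⟨fun h => by simpa using h.inv hτ (inv_mem_supported hπ), fun h => h.inv hτ hπ⟩

theorem pattern132_involutive (i : Fin 3) : pattern132 (pattern132 i) = i := by
  simp [pattern132]

end patterns

/-! ### Decomposition of 132-avoiders at the maximum. -/

section decomposition

variable {n a b j k m : ℕ} {π α β σ μ : Perm ℕ} {τ : Perm (Fin k)} {τ' : Perm (Fin (k + 1))}

theorem mem_avoiders_succ_iff (hτ : IsExtension τ τ') (hπ : π ∈ supportedBelow n) :
    π ∈ avoiders τ' (n + 1) ↔ π ∈ avoiders τ n := by
  simp only [avoiders, Set.mem_ofPred_eq, containsBelow_succ_iff hτ hπ,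
    containsBelow_succ_pattern132_iff hπ, hπ, supported_mono hπ (Nat.le_succ n)]

theorem skew_mem_avoiders_iff (hτ : τ' (Fin.last k) = Fin.last k) (hα : α ∈ supportedBelow a)
    (hβ : β ∈ supportedBelow b) :
    skew a b α β ∈ avoiders τ' (a + b) ↔ α ∈ avoiders τ' a ∧ β ∈ avoiders τ' b := by
  have h132 : pattern132 0 = 0 := by decide
  simp only [avoiders, Set.mem_ofPred_eq, containsBelow_skew_iff hα hβ (Or.inl hτ),
    containsBelow_skew_iff hα hβ (Or.inr h132), hα, hβ, skew_supported hα hβ]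
  tauto

theorem inv_mem_avoiders_iff (hτ : ∀ i, τ (τ i) = i) (hα : α ∈ supportedBelow n) :
    α⁻¹ ∈ avoiders τ n ↔ α ∈ avoiders τ n := by
  simp only [avoiders, Set.mem_ofPred_eq, containsBelow_inv_iff hτ hα,
    containsBelow_inv_iff pattern132_involutive hα, hα, inv_mem_supported hα]

/-- A letter after the maximum that exceeded `π i` would complete a 132 with `π i` and the maximum.
So the `b` distinct later values all lie below `π i`. -/
theorem le_apply_of_avoids (hπ : π ∈ supportedBelow (j + 1 + b))
    (h : ¬ ContainsBelow (j + 1 + b) π pattern132) (hj : π j = j + b) :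
    ∀ i < j + 1, b ≤ π i := by
  intro i hi
  rcases (Nat.lt_succ_iff.1 hi).eq_or_lt with rfl | hi
  · omega
  have hsub : ((Finset.range b).image fun t => π (j + 1 + t)) ⊆ Finset.range (π i) := by
    intro v hv
    obtain ⟨t, ht, rfl⟩ := Finset.mem_image.1 hv
    have ht := Finset.mem_range.1 ht
    rw [Finset.mem_range]
    by_contra hc
    have hne : π i ≠ π (j + 1 + t) := fun h => by have := π.injective h; omega
    have hne' : π j ≠ π (j + 1 + t) := fun h => by have := π.injective h; omega
    have hlt : π (j + 1 + t) < j + 1 + b := lt_of_supported hπ (by omega)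
    exact h (containsBelow_pattern132_iff.2
      ⟨i, j, j + 1 + t, hi, by omega, by omega, by omega, by omega⟩)
  have hcard := Finset.card_le_card hsub
  rwa [Finset.card_image_of_injective _ fun s t hst => by
    have := π.injective hst; omega, Finset.card_range, Finset.card_range] at hcard

/-- Here α is supported below `j` but used as a block of size `j + 1`, where it reads as α ⊕ 1. -/
theorem exists_skew_of_apply (hπ : π ∈ supportedBelow (j + 1 + b))
    (h : ¬ ContainsBelow (j + 1 + b) π pattern132) (hj : π j = j + b) :
    ∃ α ∈ supportedBelow j, ∃ β ∈ supportedBelow b, π = skew (j + 1) b α β := by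
  obtain ⟨α, hα, β, hβ, rfl⟩ := exists_eq_skew hπ (le_apply_of_avoids hπ h hj)
  rw [skew_left hα (Nat.lt_succ_self j)] at hj
  exact ⟨α, supported_of_succ hα (by omega), β, hβ, rfl⟩

/-- The involution `σ ⊖ μ ⊖ σ⁻¹`. -/
def skewConj (a m : ℕ) (σ μ : Perm ℕ) : Perm ℕ := skew a (m + a) σ (skew m a μ σ⁻¹)

theorem skewConj_left (hσ : σ ∈ supportedBelow a) {i : ℕ} (hi : i < a) :
    skewConj a m σ μ i = σ i + (m + a) := skew_left hσ hi

theorem skewConj_mid (hσ : σ ∈ supportedBelow a) (hμ : μ ∈ supportedBelow m) {i : ℕ}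
    (hi : i < m) : skewConj a m σ μ (i + a) = μ i + a := by
  rw [skewConj, skew_right hσ (skew_supported hμ (inv_mem_supported hσ)) (by omega),
    skew_left hμ hi]

theorem skewConj_right (hσ : σ ∈ supportedBelow a) (hμ : μ ∈ supportedBelow m) {i : ℕ}
    (hi : i < a) : skewConj a m σ μ (i + (m + a)) = σ⁻¹ i := by
  have h := skew_right hσ (skew_supported hμ (inv_mem_supported hσ))
    (show i + m < m + a by omega)
  rw [add_assoc] at h
  rw [skewConj, h, skew_right hμ (inv_mem_supported hσ) hi]

theorem skewConj_supported (hσ : σ ∈ supportedBelow a) (hμ : μ ∈ supportedBelow m) :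
    skewConj a m σ μ ∈ supportedBelow (a + (m + a)) :=
  skew_supported hσ (skew_supported hμ (inv_mem_supported hσ))

theorem skewConj_involutive_iff (hσ : σ ∈ supportedBelow a) (hμ : μ ∈ supportedBelow m) :
    (∀ i, skewConj a m σ μ (skewConj a m σ μ i) = i) ↔ ∀ i, μ (μ i) = i := by
  constructor
  · intro h i
    by_cases hi : i < m
    · have := h (i + a)
      rw [skewConj_mid hσ hμ hi, skewConj_mid hσ hμ (lt_of_supported hμ hi)] at this
      omega
    · rw [hμ i (by omega), hμ i (by omega)]
  · intro h i
    have hσ' := inv_mem_supported hσ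
    rcases lt_or_ge i a with hi | hi
    · rw [skewConj_left hσ hi, skewConj_right hσ hμ (lt_of_supported hσ hi), show σ⁻¹ (σ i) = i from σ.symm_apply_apply i]
    rcases lt_or_ge i (m + a) with hi' | hi'
    · obtain ⟨t, rfl⟩ := Nat.exists_eq_add_of_le' hi
      have ht : t < m := by omega
      rw [skewConj_mid hσ hμ ht, skewConj_mid hσ hμ (lt_of_supported hμ ht), h]
    rcases lt_or_ge i (a + (m + a)) with hi'' | hi''
    · obtain ⟨t, rfl⟩ := Nat.exists_eq_add_of_le' hi'
      have ht : t < a := by omega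
      rw [skewConj_right hσ hμ ht, skewConj_left hσ (lt_of_supported hσ' ht),
        show σ (σ⁻¹ t) = t from σ.apply_symm_apply t]
    · rw [skewConj_supported hσ hμ i hi'', skewConj_supported hσ hμ i hi'']

theorem skewConj_mem_iff (hτ : IsExtension τ τ') (hinv : ∀ i, τ' (τ' i) = i)
    (hσ : σ ∈ supportedBelow j) (hμ : μ ∈ supportedBelow m) :
    skewConj (j + 1) m σ μ ∈ involutiveAvoiders τ' (j + 1 + (m + (j + 1))) ↔
      σ ∈ avoiders τ j ∧ μ ∈ involutiveAvoiders τ' m := by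
  have hσ' := supported_mono hσ (Nat.le_succ j)
  have hσi := inv_mem_supported hσ'
  simp only [involutiveAvoiders, Set.mem_ofPred_eq, skewConj_involutive_iff hσ' hμ]
  rw [skewConj, skew_mem_avoiders_iff hτ.1 hσ' (skew_supported hμ hσi),
    skew_mem_avoiders_iff hτ.1 hμ hσi, inv_mem_avoiders_iff hinv hσ',
    mem_avoiders_succ_iff hτ hσ]
  tauto

theorem lt_of_involutive_apply (hπ : π ∈ supportedBelow (n + 1)) (hi : ∀ i, π (π i) = i)
    (h : ¬ ContainsBelow (n + 1) π pattern132) (hj : π j = n) (hjn : j < n) : 2 * j + 1 ≤ n := by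
  obtain ⟨b, rfl⟩ := Nat.exists_eq_add_of_le hjn.le
  rw [show j + b + 1 = j + 1 + b by omega] at hπ h
  obtain ⟨α, hα, β, hβ, rfl⟩ := exists_skew_of_apply hπ h hj
  have h1 := hi j
  rw [hj] at h1
  -- The last position holds the value `j` and lies in the right block, whose values are below `b`;
  -- so `j < b`.
  have h2 := skew_right (supported_mono hα (Nat.le_succ j)) hβ (show b - 1 < b by omega)
  rw [show b - 1 + (j + 1) = j + b by omega, h1] at h2
  have := lt_of_supported hβ (show b - 1 < b by omega)
  omega

theorem exists_skewConj (hπ : π ∈ supportedBelow (j + 1 + (m + (j + 1))))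
    (hi : ∀ i, π (π i) = i) (h : ¬ ContainsBelow (j + 1 + (m + (j + 1))) π pattern132)
    (hj : π j = j + (m + (j + 1))) :
    ∃ σ ∈ supportedBelow j, ∃ μ ∈ supportedBelow m, π = skewConj (j + 1) m σ μ := by
  obtain ⟨σ, hσ, ρ, hρ, rfl⟩ := exists_skew_of_apply hπ h hj
  have hσ' := supported_mono hσ (Nat.le_succ j)
  -- A smaller value would be a position in the left block, which π sends to the top values and not
  -- back to the middle.
  have hge : ∀ i < m, j + 1 ≤ ρ i := by
    intro i him
    by_contra hc
    have h1 := hi (i + (j + 1))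
    rw [skew_right hσ' hρ (by omega), skew_left hσ' (by omega)] at h1
    omega
  obtain ⟨μ, hμ, ν, hν, rfl⟩ := exists_eq_skew hρ hge
  refine ⟨σ, hσ, μ, hμ, ?_⟩
  have hνσ : ν = σ⁻¹ := by
    refine supported_ext hν (inv_mem_supported hσ') fun i hi' => ?_
    rw [eq_comm, Perm.inv_eq_iff_eq]
    have h1 := hi (i + m + (j + 1))
    rw [skew_right hσ' hρ (by omega), skew_right hμ hν hi',
      skew_left hσ' (lt_of_supported hν hi')] at h1
    omega
  rw [skewConj, hνσ]

/-- The two outer blocks exchange the lowest and highest `a` numbers, so they fix nothing. -/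
theorem fixedBelow_skewConj (hσ : σ ∈ supportedBelow a) (hμ : μ ∈ supportedBelow m) :
    fixedBelow (a + (m + a)) (skewConj a m σ μ) = fixedBelow m μ := by
  refine Eq.trans ?_ (Finset.card_map (addRightEmbedding a))
  rw [fixedBelow]
  congr 1
  ext i
  simp only [Finset.mem_filter, Finset.mem_range, Finset.mem_map, addRightEmbedding_apply]
  constructor
  · rintro ⟨hi, hfix⟩
    rcases lt_or_ge i a with h1 | h1
    · rw [skewConj_left hσ h1] at hfix
      omega
    obtain ⟨t, rfl⟩ := Nat.exists_eq_add_of_le' h1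
    rcases lt_or_ge t m with h2 | h2
    · rw [skewConj_mid hσ hμ h2] at hfix
      exact ⟨t, ⟨h2, by omega⟩, rfl⟩
    · obtain ⟨s, rfl⟩ := Nat.exists_eq_add_of_le' h2
      rw [add_assoc, skewConj_right hσ hμ (by omega)] at hfix
      have := lt_of_supported (inv_mem_supported hσ) (show s < a by omega)
      omega
  · rintro ⟨t, ⟨ht, hfix⟩, rfl⟩
    exact ⟨by omega, by rw [skewConj_mid hσ hμ ht, hfix]⟩

theorem fixedBelow_succ (h : π n = n) : fixedBelow (n + 1) π = fixedBelow n π + 1 := by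
  rw [fixedBelow, Finset.range_add_one, Finset.filter_insert, if_pos h,
    Finset.card_insert_of_notMem (by simp), fixedBelow]

end decomposition


/-! ### Bijections by induction on pattern and length. -/

section bijections

variable {n b j k m : ℕ} {τ : Perm (Fin k)} {τ' : Perm (Fin (k + 1))}

theorem apply_eq_iff_inv_apply_eq (π : Perm ℕ) (j n : ℕ) : π j = n ↔ π⁻¹ n = j := by
  rw [Perm.inv_eq_iff_eq, eq_comm]

/-- Glues bijections between fibers. It is applied with the index the position of the maximum, and
`s`, `t` the capped numbers of fixed points. -/
theorem exists_equiv_of_fibers {A B ι κ : Type*} {P : A → ι → Prop} {Q : B → ι → Prop}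
    (f : A → ι) (g : B → ι) (hP : ∀ x i, P x i ↔ f x = i) (hQ : ∀ y i, Q y i ↔ g y = i)
    (s : A → κ) (t : B → κ) (h : ∀ i, ∃ e : {x // P x i} ≃ {y // Q y i}, ∀ x, t (e x) = s x) :
    ∃ e : A ≃ B, ∀ x, t (e x) = s x := by
  obtain rfl : P = fun x i => f x = i := funext₂ fun x i => propext (hP x i)
  obtain rfl : Q = fun y i => g y = i := funext₂ fun y i => propext (hQ y i)
  choose e he using h
  refine ⟨(sigmaFiberEquiv f).symm.trans ((sigmaCongrRight e).trans (sigmaFiberEquiv g)),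
    fun x => ?_⟩
  exact he (f x) ⟨x, rfl⟩

theorem exists_equiv_avoiders_fiber (hτ : IsExtension τ τ') :
    Nonempty (avoiders τ j × avoiders τ' b ≃
      {π : avoiders τ' (j + 1 + b) // π.1 j = j + b}) := by
  have hs : ∀ p : avoiders τ j × avoiders τ' b, p.1.1 ∈ supportedBelow (j + 1) :=
    fun p => supported_mono p.1.2.1 (Nat.le_succ j)
  have hmem : ∀ p : avoiders τ j × avoiders τ' b,
      skew (j + 1) b p.1.1 p.2.1 ∈ avoiders τ' (j + 1 + b) := fun p =>
    (skew_mem_avoiders_iff hτ.1 (hs p) p.2.2.1).2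
      ⟨(mem_avoiders_succ_iff hτ p.1.2.1).2 p.1.2, p.2.2⟩
  refine ⟨Equiv.ofBijective (fun p => ⟨⟨_, hmem p⟩, ?_⟩) ⟨fun p q hpq => ?_, ?_⟩⟩
  · change skew (j + 1) b p.1.1 p.2.1 j = j + b
    rw [skew_left (hs p) (Nat.lt_succ_self j), p.1.2.1 j le_rfl]
  · have h := skew_injective (hs p) p.2.2.1 (hs q) q.2.2.1
      (congrArg (fun x => x.1.1) hpq)
    exact Prod.ext (Subtype.ext h.1) (Subtype.ext h.2)
  · rintro ⟨⟨π, hπ⟩, hj⟩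
    obtain ⟨α, hα, β, hβ, rfl⟩ := exists_skew_of_apply hπ.1 hπ.2.1 hj
    have h := (skew_mem_avoiders_iff hτ.1 (supported_mono hα (Nat.le_succ j)) hβ).1 hπ
    exact ⟨⟨⟨α, (mem_avoiders_succ_iff hτ hα).1 h.1⟩, ⟨β, h.2⟩⟩, rfl⟩

theorem exists_equiv_involutiveAvoiders_fiber (hτ : IsExtension τ τ')
    (hinv : ∀ i, τ' (τ' i) = i) :
    ∃ e : avoiders τ j × involutiveAvoiders τ' m ≃
      {π : involutiveAvoiders τ' (j + 1 + (m + (j + 1))) // π.1 j = j + (m + (j + 1))},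
      ∀ p, fixedBelow (j + 1 + (m + (j + 1))) (e p).1.1 = fixedBelow m p.2.1 := by
  have hs : ∀ p : avoiders τ j × involutiveAvoiders τ' m, p.1.1 ∈ supportedBelow (j + 1) :=
    fun p => supported_mono p.1.2.1 (Nat.le_succ j)
  have hmem : ∀ p : avoiders τ j × involutiveAvoiders τ' m,
      skewConj (j + 1) m p.1.1 p.2.1 ∈ involutiveAvoiders τ' (j + 1 + (m + (j + 1))) := fun p =>
    (skewConj_mem_iff hτ hinv p.1.2.1 p.2.2.1.1).2 ⟨p.1.2, p.2.2⟩
  refine ⟨Equiv.ofBijective (fun p => ⟨⟨_, hmem p⟩, ?_⟩) ⟨fun p q hpq => ?_, ?_⟩, fun p => ?_⟩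
  · change skewConj (j + 1) m p.1.1 p.2.1 j = _
    rw [skewConj_left (hs p) (Nat.lt_succ_self j), p.1.2.1 j le_rfl]
  · have hp := skew_supported p.2.2.1.1 (inv_mem_supported (hs p))
    have hq := skew_supported q.2.2.1.1 (inv_mem_supported (hs q))
    have h := skew_injective (hs p) hp (hs q) hq (congrArg (fun x => x.1.1) hpq)
    have h' := skew_injective p.2.2.1.1 (inv_mem_supported (hs p)) q.2.2.1.1
      (inv_mem_supported (hs q)) h.2
    exact Prod.ext (Subtype.ext h.1) (Subtype.ext h'.1)
  · rintro ⟨⟨π, hπ⟩, hj⟩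
    obtain ⟨σ, hσ, μ, hμ, rfl⟩ := exists_skewConj hπ.1.1 hπ.2 hπ.1.2.1 hj
    have h := (skewConj_mem_iff hτ hinv hσ hμ).1 hπ
    exact ⟨⟨⟨σ, h.1⟩, ⟨μ, h.2⟩⟩, rfl⟩
  · exact fixedBelow_skewConj (hs p) p.2.2.1.1

theorem exists_equiv_involutiveAvoiders_top (hτ : IsExtension τ τ') :
    ∃ e : involutiveAvoiders τ n ≃ {π : involutiveAvoiders τ' (n + 1) // π.1 n = n},
      ∀ π, fixedBelow (n + 1) (e π).1.1 = fixedBelow n π.1 + 1 := by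
  refine ⟨Equiv.ofBijective (fun π => ⟨⟨π.1, (mem_avoiders_succ_iff hτ π.2.1.1).2 π.2.1, π.2.2⟩,
    π.2.1.1 n le_rfl⟩) ⟨fun p q hpq => ?_, ?_⟩, fun π => ?_⟩
  · exact Subtype.ext (congrArg (fun x => x.1.1) hpq)
  · rintro ⟨⟨π, hπ⟩, hn⟩
    exact ⟨⟨π, (mem_avoiders_succ_iff hτ (supported_of_succ hπ.1.1 hn)).1 hπ.1, hπ.2⟩, rfl⟩
  · exact fixedBelow_succ (π.2.1.1 n le_rfl)

theorem eq_one_of_mem_zero {π : Perm ℕ} (h : π ∈ supportedBelow 0) : π = 1 := by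
  ext i
  exact h i (Nat.zero_le i)

theorem one_mem_involutiveAvoiders_zero : 1 ∈ involutiveAvoiders τ' 0 := by
  refine ⟨⟨fun i _ => rfl, ?_, ?_⟩, fun i => rfl⟩
  · rintro ⟨f, -, hf, -⟩
    exact absurd (hf 0) (Nat.not_lt_zero _)
  · rintro ⟨f, -, hf, -⟩
    exact absurd (hf 0) (Nat.not_lt_zero _)

variable {c : ℕ} {X Y : ∀ k : ℕ, Perm (Fin (c + 1 + k))}

/-- Needed for the factor σ, which is not required to be an involution; as it carries no fixed
points, no statistic has to be tracked. -/
theorem nonempty_equiv_avoiders (hX : ∀ k, IsExtension (X k) (X (k + 1)))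
    (hY : ∀ k, IsExtension (Y k) (Y (k + 1)))
    (h0 : ∀ n, Nonempty (avoiders (X 0) n ≃ avoiders (Y 0) n)) (k n : ℕ) :
    Nonempty (avoiders (X k) n ≃ avoiders (Y k) n) := by
  induction k generalizing n with
  | zero => exact h0 n
  | succ k ihk =>
    induction n using Nat.strong_induction_on with
    | _ n ihn =>
    rcases n with _ | n
    · exact ⟨⟨fun _ => ⟨1, one_mem_involutiveAvoiders_zero.1⟩,
        fun _ => ⟨1, one_mem_involutiveAvoiders_zero.1⟩,
        fun π => Subtype.ext (eq_one_of_mem_zero π.2.1).symm,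
        fun π => Subtype.ext (eq_one_of_mem_zero π.2.1).symm⟩⟩
    · obtain ⟨e, -⟩ := exists_equiv_of_fibers
        (fun π : avoiders (X (k + 1)) (n + 1) => π.1⁻¹ n)
        (fun π : avoiders (Y (k + 1)) (n + 1) => π.1⁻¹ n)
        (fun π j => apply_eq_iff_inv_apply_eq π.1 j n)
        (fun π j => apply_eq_iff_inv_apply_eq π.1 j n) (fun _ => ()) (fun _ => ()) fun j => by
          suffices h : Nonempty ({π : avoiders (X (k + 1)) (n + 1) // π.1 j = n} ≃
              {π : avoiders (Y (k + 1)) (n + 1) // π.1 j = n}) from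
            h.elim fun e => ⟨e, fun _ => rfl⟩
          rcases lt_or_ge n j with hj | hj
          · have hempty : ∀ (τ : Perm (Fin (c + 1 + (k + 1)))) (π : avoiders τ (n + 1)),
                π.1 j ≠ n := by
              intro τ π hπ
              have := π.2.1 j hj
              omega
            have := Subtype.isEmpty_of_false (hempty (X (k + 1)))
            have := Subtype.isEmpty_of_false (hempty (Y (k + 1)))
            exact ⟨Equiv.equivOfIsEmpty _ _⟩
          · obtain ⟨b, rfl⟩ := Nat.exists_eq_add_of_le hj
            obtain ⟨e1⟩ := ihk j
            obtain ⟨e2⟩ := ihn b (by omega)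
            rw [show j + b + 1 = j + 1 + b by omega]
            obtain ⟨eX⟩ := exists_equiv_avoiders_fiber (j := j) (b := b) (hX k)
            obtain ⟨eY⟩ := exists_equiv_avoiders_fiber (j := j) (b := b) (hY k)
            exact ⟨eX.symm.trans ((e1.prodCongr e2).trans eY)⟩
      exact ⟨e⟩

theorem exists_equiv_involutiveAvoiders (hX : ∀ k, IsExtension (X k) (X (k + 1)))
    (hY : ∀ k, IsExtension (Y k) (Y (k + 1)))
    (hXi : ∀ k i, X k (X k i) = i) (hYi : ∀ k i, Y k (Y k i) = i)
    (h0 : ∀ n, Nonempty (avoiders (X 0) n ≃ avoiders (Y 0) n))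
    (h0' : ∀ n, Nonempty (involutiveAvoiders (X 0) n ≃ involutiveAvoiders (Y 0) n)) (k n : ℕ) :
    ∃ e : involutiveAvoiders (X k) n ≃ involutiveAvoiders (Y k) n,
      ∀ π, min (fixedBelow n (e π).1) k = min (fixedBelow n π.1) k := by
  induction k generalizing n with
  | zero => exact (h0' n).elim fun e => ⟨e, fun _ => by simp⟩
  | succ k ihk =>
    induction n using Nat.strong_induction_on with
    | _ n ihn =>
    rcases n with _ | n
    · exact ⟨⟨fun _ => ⟨1, one_mem_involutiveAvoiders_zero⟩,
        fun _ => ⟨1, one_mem_involutiveAvoiders_zero⟩,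
        fun π => Subtype.ext (eq_one_of_mem_zero π.2.1.1).symm,
        fun π => Subtype.ext (eq_one_of_mem_zero π.2.1.1).symm⟩, fun π => rfl⟩
    · refine exists_equiv_of_fibers
        (fun π : involutiveAvoiders (X (k + 1)) (n + 1) => π.1⁻¹ n)
        (fun π : involutiveAvoiders (Y (k + 1)) (n + 1) => π.1⁻¹ n)
        (fun π j => apply_eq_iff_inv_apply_eq π.1 j n)
        (fun π j => apply_eq_iff_inv_apply_eq π.1 j n)
        (fun π => min (fixedBelow (n + 1) π.1) (k + 1))
        (fun π => min (fixedBelow (n + 1) π.1) (k + 1)) fun j => ?_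
      -- On this fiber the counts and the cap both go up by one from the shorter patterns. On the
      -- others the cap `k + 1` is inherited from the shorter μ.
      by_cases hjn : j = n
      · subst hjn
        obtain ⟨e, he⟩ := ihk j
        obtain ⟨eX, heX⟩ := exists_equiv_involutiveAvoiders_top (n := j) (hX k)
        obtain ⟨eY, heY⟩ := exists_equiv_involutiveAvoiders_top (n := j) (hY k)
        refine ⟨eX.symm.trans (e.trans eY), fun π => ?_⟩
        obtain ⟨π, rfl⟩ := eX.surjective π
        have := he π
        simp only [Equiv.trans_apply, Equiv.symm_apply_apply, heX, heY]
        omega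
      by_cases hj : 2 * j + 1 ≤ n
      · obtain ⟨m, rfl⟩ := Nat.exists_eq_add_of_le hj
        obtain ⟨e1⟩ := nonempty_equiv_avoiders hX hY h0 k j
        obtain ⟨e2, he2⟩ := ihn m (by omega)
        rw [show 2 * j + 1 + m + 1 = j + 1 + (m + (j + 1)) by omega,
          show 2 * j + 1 + m = j + (m + (j + 1)) by omega]
        obtain ⟨eX, heX⟩ :=
          exists_equiv_involutiveAvoiders_fiber (j := j) (m := m) (hX k) (hXi (k + 1))
        obtain ⟨eY, heY⟩ :=
          exists_equiv_involutiveAvoiders_fiber (j := j) (m := m) (hY k) (hYi (k + 1))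
        refine ⟨eX.symm.trans ((e1.prodCongr e2).trans eY), fun π => ?_⟩
        obtain ⟨π, rfl⟩ := eX.surjective π
        simp only [Equiv.trans_apply, Equiv.symm_apply_apply, heX, heY]
        exact he2 π.2
      · have hempty : ∀ (τ : Perm (Fin (c + 1 + (k + 1)))) (π : involutiveAvoiders τ (n + 1)),
            π.1 j ≠ n := by
          intro τ π hπ
          rcases lt_or_gt_of_ne hjn with h | h
          · exact hj (lt_of_involutive_apply π.2.1.1 π.2.2 π.2.1.2.1 hπ h)
          · have := π.2.1.1 j h
            omega
        have := Subtype.isEmpty_of_false (hempty (X (k + 1)))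
        have := Subtype.isEmpty_of_false (hempty (Y (k + 1)))
        exact ⟨Equiv.equivOfIsEmpty _ _, fun π => isEmptyElim π⟩

end bijections

/-! ### The base patterns 12 and 21. -/

section base

variable {n : ℕ} {π : Perm ℕ}

/-- The permutation reversing the numbers below `n`. -/
def reversal (n : ℕ) : Perm ℕ where
  toFun i := if i < n then n - 1 - i else i
  invFun i := if i < n then n - 1 - i else i
  left_inv i := by dsimp only; split_ifs <;> omega
  right_inv i := by dsimp only; split_ifs <;> omega

theorem reversal_apply {i : ℕ} (hi : i < n) : reversal n i = n - 1 - i := if_pos hi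

theorem reversal_supported : reversal n ∈ supportedBelow n := fun _ hi => if_neg hi.not_gt

theorem le_apply_of_increasing {f : ℕ → ℕ} (h : ∀ i j, i < j → j < n → f i < f j) :
    ∀ i < n, i ≤ f i := by
  intro i
  induction i with
  | zero => intro _; exact Nat.zero_le _
  | succ i ih =>
    intro hi
    have := ih (by omega)
    have := h i (i + 1) (by omega) hi
    omega

theorem eq_one_of_increasing (hπ : π ∈ supportedBelow n)
    (h : ∀ i j, i < j → j < n → π i < π j) : π = 1 := by
  refine supported_ext hπ (fun _ _ => rfl) fun i hi => ?_
  have h1 := le_apply_of_increasing h i hi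
  have hinv : ∀ i j, i < j → j < n → π⁻¹ i < π⁻¹ j := by
    intro i j hij hj
    have hi' := lt_of_supported (inv_mem_supported hπ) (hij.trans hj)
    have hne : π⁻¹ i ≠ π⁻¹ j := fun he => hij.ne (π⁻¹.injective he)
    by_contra hc
    have := h (π⁻¹ j) (π⁻¹ i) (by omega) hi'
    simp at this
    omega
  -- The inverse is increasing too, whence `π i ≤ i`.
  have h2 := le_apply_of_increasing hinv (π i) (lt_of_supported hπ hi)
  simp at h2 ⊢
  omega

theorem eq_reversal_of_decreasing (hπ : π ∈ supportedBelow n)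
    (h : ∀ i j, i < j → j < n → π j < π i) : π = reversal n := by
  have h1 : reversal n * π = 1 := by
    refine eq_one_of_increasing (n := n) (fun i hi => ?_) fun i j hij hj => ?_
    · rw [Perm.mul_apply, hπ i hi, reversal_supported i hi]
    · have h2 := h i j hij hj
      have h3 := lt_of_supported hπ (hij.trans hj)
      rw [Perm.mul_apply, Perm.mul_apply, reversal_apply h3, reversal_apply (h2.trans h3)]
      omega
  refine supported_ext hπ reversal_supported fun i hi => ?_
  have h2 := congrArg (fun ρ : Perm ℕ => ρ i) h1
  have h3 := lt_of_supported hπ hi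
  simp only [Perm.mul_apply, reversal_apply h3, Perm.one_apply] at h2
  rw [reversal_apply hi]
  omega

theorem containsBelow_pair_iff {τ : Perm (Fin 2)} :
    ContainsBelow n π τ ↔ ∃ x y, x < y ∧ y < n ∧ (π x < π y ↔ τ 0 < τ 1) := by
  constructor
  · rintro ⟨f, hf, hfn, hft⟩
    exact ⟨f 0, f 1, hf (by decide), hfn 1, hft 0 1⟩
  · rintro ⟨x, y, hxy, hy, h⟩
    refine ⟨![x, y], ?_, ?_, ?_⟩
    · intro i j hij
      fin_cases i <;> fin_cases j <;> simp at hij ⊢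
      exact hxy
    · intro i
      fin_cases i <;> simp <;> omega
    · have h1 : π x ≠ π y := fun he => hxy.ne (π.injective he)
      have h2 : τ 0 ≠ τ 1 := fun he => by simpa using τ.injective he
      intro i j
      fin_cases i <;> fin_cases j <;> simp <;> omega

theorem avoiders_increasing : avoiders (patternIncreasing 2) n = {reversal n} := by
  have h12 : patternIncreasing 2 0 < patternIncreasing 2 1 := by decide
  ext π
  rw [Set.mem_singleton_iff]
  constructor
  · rintro ⟨hπ, -, h⟩
    refine eq_reversal_of_decreasing hπ fun i j hij hj => ?_
    have h1 : π i ≠ π j := fun he => hij.ne (π.injective he)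
    by_contra hc
    exact h (containsBelow_pair_iff.2 ⟨i, j, hij, hj, by simp only [h12, iff_true]; omega⟩)
  · rintro rfl
    have hdec : ∀ x y, x < y → y < n → ¬ reversal n x < reversal n y := by
      intro x y hxy hy
      rw [reversal_apply hy, reversal_apply (hxy.trans hy)]
      omega
    refine ⟨reversal_supported, ?_, ?_⟩
    · rw [containsBelow_pattern132_iff]
      rintro ⟨x, y, z, hxy, hyz, hz, hxz, -⟩
      exact hdec x z (hxy.trans hyz) hz hxz
    · rw [containsBelow_pair_iff]
      rintro ⟨x, y, hxy, hy, h⟩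
      exact hdec x y hxy hy (h.2 h12)

theorem avoiders_2134 : avoiders (pattern2134 2 le_rfl) n = {1} := by
  have h21 : ¬ pattern2134 2 le_rfl 0 < pattern2134 2 le_rfl 1 := by decide
  ext π
  rw [Set.mem_singleton_iff]
  constructor
  · rintro ⟨hπ, -, h⟩
    refine eq_one_of_increasing hπ fun i j hij hj => ?_
    by_contra hc
    exact h (containsBelow_pair_iff.2 ⟨i, j, hij, hj, by simp only [h21, hc]⟩)
  · rintro rfl
    refine ⟨fun _ _ => rfl, ?_, ?_⟩
    · rw [containsBelow_pattern132_iff]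
      rintro ⟨x, y, z, hxy, hyz, hz, hxz, hzy⟩
      exact absurd hzy hyz.not_gt
    · rw [containsBelow_pair_iff]
      rintro ⟨x, y, hxy, hy, h⟩
      exact h21 (h.1 hxy)

theorem involutiveAvoiders_increasing :
    involutiveAvoiders (patternIncreasing 2) n = {reversal n} := by
  ext π
  rw [involutiveAvoiders, avoiders_increasing]
  simp only [Set.mem_singleton_iff, Set.mem_ofPred_eq, and_iff_left_iff_imp]
  rintro rfl i
  exact (reversal n).left_inv i

theorem involutiveAvoiders_2134 : involutiveAvoiders (pattern2134 2 le_rfl) n = {1} := by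
  ext π
  rw [involutiveAvoiders, avoiders_2134]
  simp only [Set.mem_singleton_iff, Set.mem_ofPred_eq, and_iff_left_iff_imp]
  rintro rfl i
  rfl

theorem isExtension_increasing (k : ℕ) :
    IsExtension (patternIncreasing k) (patternIncreasing (k + 1)) := ⟨rfl, fun _ => rfl⟩

theorem isExtension_2134 (k : ℕ) (hk : 2 ≤ k) (hk' : 2 ≤ k + 1) :
    IsExtension (pattern2134 k hk) (pattern2134 (k + 1) hk') := by
  constructor
  · apply swap_apply_of_ne_of_ne <;> simp [Fin.ext_iff] <;> omega
  · intro i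
    simp only [pattern2134, swap_apply_def, Fin.ext_iff, Fin.val_castSucc]
    split_ifs <;> rfl

end base

/-! ### Transfer between `Perm (Fin n)` and `Perm ℕ`. -/

section transfer

variable {n k : ℕ}

/-- The permutation of `ℕ` that extends `α` by fixed points. -/
def extend (α : Perm (Fin n)) : Perm ℕ := α.extendDomain Fin.equivSubtype

theorem extend_apply (α : Perm (Fin n)) (i : Fin n) : extend α i = α i :=
  α.extendDomain_apply_image Fin.equivSubtype i

theorem extend_supported (α : Perm (Fin n)) : extend α ∈ supportedBelow n :=
  fun _ hi => α.extendDomain_apply_not_subtype Fin.equivSubtype (not_lt.2 hi)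

theorem extend_injective : Function.Injective (extend : Perm (Fin n) → Perm ℕ) := by
  intro α β h
  ext i
  rw [← extend_apply, h, extend_apply]

theorem exists_extend_eq {π : Perm ℕ} (hπ : π ∈ supportedBelow n) :
    ∃ α : Perm (Fin n), extend α = π := by
  have hπ' := inv_mem_supported hπ
  refine ⟨⟨fun i => ⟨π i, lt_of_supported hπ i.2⟩, fun i => ⟨π⁻¹ i, lt_of_supported hπ' i.2⟩,
    fun i => by simp, fun i => by simp⟩, ?_⟩
  exact supported_ext (extend_supported _) hπ fun i hi => extend_apply _ ⟨i, hi⟩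

theorem containsBelow_extend_iff (α : Perm (Fin n)) (τ : Perm (Fin k)) :
    ContainsBelow n (extend α) τ ↔ Contains α τ := by
  constructor
  · rintro ⟨f, hf, hfn, hft⟩
    refine ⟨fun i => ⟨f i, hfn i⟩, fun i j hij => hf hij, fun i j => ?_⟩
    rw [← hft, Fin.lt_def, ← extend_apply, ← extend_apply]
  · rintro ⟨f, hf, hft⟩
    refine ⟨fun i => f i, fun i j hij => hf hij, fun i => (f i).2, fun i j => ?_⟩
    rw [← hft, Fin.lt_def, ← extend_apply, ← extend_apply]

theorem extend_involutive_iff (α : Perm (Fin n)) :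
    (∀ i, extend α (extend α i) = i) ↔ Function.Involutive α := by
  constructor
  · intro h i
    rw [Fin.ext_iff, ← extend_apply, ← extend_apply]
    exact h i
  · intro h i
    by_cases hi : i < n
    · rw [show extend α i = α ⟨i, hi⟩ from extend_apply α ⟨i, hi⟩, extend_apply, h]
    · rw [extend_supported α i (not_lt.1 hi), extend_supported α i (not_lt.1 hi)]

theorem fixedBelow_extend (α : Perm (Fin n)) : fixedBelow n (extend α) = numFixedPoints α := by
  rw [numFixedPoints]
  refine Eq.trans ?_ (Finset.card_map Fin.valEmbedding)
  rw [fixedBelow]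
  congr 1
  ext i
  simp only [Finset.mem_filter, Finset.mem_range, Finset.mem_map, Finset.mem_univ, true_and,
    Fin.valEmbedding_apply]
  constructor
  · rintro ⟨hi, h⟩
    exact ⟨⟨i, hi⟩, Fin.ext ((extend_apply α ⟨i, hi⟩).symm.trans h), rfl⟩
  · rintro ⟨x, hx, rfl⟩
    exact ⟨x.2, by rw [extend_apply, hx]⟩

theorem exists_equiv_extend (τ : Perm (Fin k)) :
    ∃ e : involutionsAvoiding132And n τ ≃ involutiveAvoiders τ n,
      ∀ α, fixedBelow n (e α).1 = numFixedPoints α.1 := by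
  have hmem : ∀ α : Perm (Fin n),
      extend α ∈ involutiveAvoiders τ n ↔ α ∈ involutionsAvoiding132And n τ := by
    intro α
    simp only [involutiveAvoiders, avoiders, involutionsAvoiding132And, Avoids,
      Set.mem_ofPred_eq, containsBelow_extend_iff, extend_involutive_iff, extend_supported]
    tauto
  refine ⟨Equiv.ofBijective (fun α => ⟨extend α.1, (hmem _).2 α.2⟩)
    ⟨fun α β h => Subtype.ext (extend_injective (congrArg Subtype.val h)), ?_⟩,
    fun α => fixedBelow_extend α.1⟩
  rintro ⟨π, hπ⟩
  obtain ⟨α, rfl⟩ := exists_extend_eq hπ.1.1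
  exact ⟨⟨α, (hmem α).1 hπ⟩, rfl⟩

/-- Fixed points form an increasing subsequence. -/
theorem numFixedPoints_lt_of_avoids {α : Perm (Fin n)} (h : Avoids α (patternIncreasing k)) :
    numFixedPoints α < k := by
  by_contra hc
  obtain ⟨s, hs, hcard⟩ := Finset.exists_subset_card_eq (not_lt.1 hc)
  have hfix : ∀ i, α (s.orderEmbOfFin hcard i) = s.orderEmbOfFin hcard i := fun i =>
    (Finset.mem_filter.1 (hs (s.orderEmbOfFin_mem hcard i))).2
  exact h ⟨s.orderEmbOfFin hcard, (s.orderEmbOfFin hcard).strictMono, fun i j => by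
    rw [hfix, hfix, OrderEmbedding.lt_iff_lt]; rfl⟩

end transfer

theorem exists_equiv_increasing_2134 (k n : ℕ) :
    ∃ e : involutiveAvoiders (patternIncreasing (1 + 1 + k)) n ≃
        involutiveAvoiders (pattern2134 (1 + 1 + k) (Nat.le_add_right 2 k)) n,
      ∀ π, min (fixedBelow n (e π).1) k = min (fixedBelow n π.1) k := by
  refine exists_equiv_involutiveAvoiders (c := 1) (X := fun k => patternIncreasing (1 + 1 + k))
    (Y := fun k => pattern2134 (1 + 1 + k) (Nat.le_add_right 2 k))
    (fun k => isExtension_increasing _) (fun k => isExtension_2134 _ _ _) (fun k i => rfl)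
    (fun k i => swap_apply_self _ _ _) (fun n => ?_) (fun n => ?_) k n
  · change Nonempty (avoiders (patternIncreasing 2) n ≃ avoiders (pattern2134 2 le_rfl) n)
    rw [avoiders_increasing, avoiders_2134]
    exact ⟨Equiv.ofUnique _ _⟩
  · change Nonempty (involutiveAvoiders (patternIncreasing 2) n ≃
      involutiveAvoiders (pattern2134 2 le_rfl) n)
    rw [involutiveAvoiders_increasing, involutiveAvoiders_2134]
    exact ⟨Equiv.ofUnique _ _⟩

end PatternInvolutions

theorem mainTheorem7 (k : ℕ) (hk : 3 ≤ k) (n : ℕ) :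
    ∃ Φ : PatternInvolutions.involutionsAvoiding132And n
            (PatternInvolutions.patternIncreasing k) ≃
          PatternInvolutions.involutionsAvoiding132And n
            (PatternInvolutions.pattern2134 k (Nat.le_of_succ_le hk)),
      (∀ π, ∀ p : ℕ, p ≤ k - 3 →
        (PatternInvolutions.numFixedPoints π.1 = p ↔
          PatternInvolutions.numFixedPoints (Φ π).1 = p)) ∧
      (∀ π,
        (PatternInvolutions.numFixedPoints π.1 = k - 2 ∨
            PatternInvolutions.numFixedPoints π.1 = k - 1) ↔
          k - 2 ≤ PatternInvolutions.numFixedPoints (Φ π).1) := by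
  -- The cap is `m = k - 2`: counts up to `k - 3` are preserved exactly, and all larger ones are
  -- lumped together.
  obtain ⟨m, rfl⟩ : ∃ m, k = 1 + 1 + m := ⟨k - 2, by omega⟩
  obtain ⟨e, he⟩ := PatternInvolutions.exists_equiv_increasing_2134 m n
  obtain ⟨eA, hA⟩ := PatternInvolutions.exists_equiv_extend (n := n)
    (PatternInvolutions.patternIncreasing (1 + 1 + m))
  obtain ⟨eB, hB⟩ := PatternInvolutions.exists_equiv_extend (n := n)
    (PatternInvolutions.pattern2134 (1 + 1 + m) (Nat.le_of_succ_le hk))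
  have key : ∀ π, min (PatternInvolutions.numFixedPoints
      ((eA.trans (e.trans eB.symm)) π).1) m = min (PatternInvolutions.numFixedPoints π.1) m := by
    intro π
    rw [← hA, ← hB, ← he]
    simp
  refine ⟨eA.trans (e.trans eB.symm), fun π p hp => ?_, fun π => ?_⟩
  · have := key π
    omega
  · have := key π
    have := PatternInvolutions.numFixedPoints_lt_of_avoids π.2.2.2
    omega
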